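/- Let $X$ be a complex Banach space with open unit ball $\mathbb B$. For $z\in X\setminus\{0\}$ let $T_z$ be the set of continuous linear functionals $l_z:X\to\mathbb C$ with $\|l_z\|=1$ and $l_z(z)=\|z\|$. A holomorphic mapping $G:\mathbb B\to X$ is called a normalized starlike mapping, $G\in\mathcal S^*(\mathbb B)$, if $G(0)=0$, $DG(0)=I$, $G$ is biholomorphic from $\mathbb B$ onto a domain $G(\mathbb B)$, and $tG(\mathbb B)\subseteq G(\mathbb B)$ for all $t\in[0,1]$. Here $D^kG(0)(z^k)$ denotes the $k$-th Fréchet derivative of $G$ at $0$ evaluated at $(z,\dots,z)$. (i) Let $g:\mathbb B\to\mathbb C$ be holomorphic with $g(0)=1$ and let $G(z)=z\,g(z)\in\mathcal S^*(\mathbb B)$. Then for all $z\in\mathbb B\setminus\{0\}$ and all $l_z\in T_z$, $$\left|\left(\frac{l_z(D^2G(0)(z^2))}{2!\,\|z\|^2}\right)^2-\left(\frac{l_z(D^3G(0)(z^3))}{3!\,\|z\|^3}\right)^2\right|\le 13 .$$ The bound is sharp: for every $u\in X$ with $\|u\|=1$ there is such a $G$ for which equality holds at every $z=ru$, $0<r<1$,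 and for every $l_z\in T_z$. (ii) Let $X=\mathbb C^n$ with the maximum norm, so that $\mathbb B=\mathbb U^n$ is the unit polydisc, and let squares of vectors be taken componentwise. Let $g:\mathbb U^n\to\mathbb C$ be holomorphic with $g(0)=1$ and let $G(z)=z\,g(z)\in\mathcal S^*(\mathbb U^n)$. Then for all $z\in\mathbb U^n$, $$\left\|\left(\frac{D^3G(0)(z^3)}{3!}\right)^2-\left(\frac{D^2G(0)(z^2)}{2!}\right)^2\right\|\le 9\|z\|^6+4\|z\|^4 .$$ The bound is sharp: for every $u\in\mathbb C^n$ with $\|u\|=1$ there is such a $G$ for which equality holds at every $z=ru$, $0\le r<1$. -/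

import Mathlib

noncomputable section

/-- Holomorphic on `U` (an open subset of a complex Banach space): near every point of `U`
the map is the sum of a convergent power series of continuous homogeneous polynomials. -/
def HolomorphicOn {E F : Type*} [NormedAddCommGroup E] [NormedSpace ℂ E]
    [NormedAddCommGroup F] [NormedSpace ℂ F] (f : E → F) (U : Set E) : Prop :=
  AnalyticOnNhd ℂ f U

/-- `f` is biholomorphic on `U`: it is holomorphic, its image is a domain (open and connected),
and it has an inverse which is holomorphic on that image. -/
def BiholomorphicOn {E : Type*} [NormedAddCommGroup E] [NormedSpace ℂ E]
    (f : E → E) (U : Set E) : Prop :=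
  HolomorphicOn f U ∧ IsOpen (f '' U) ∧ IsConnected (f '' U) ∧
    ∃ h : E → E, HolomorphicOn h (f '' U) ∧ ∀ z ∈ U, h (f z) = z

/-- The class of normalized starlike mappings on the open unit ball: biholomorphic maps `G` with
`G(0) = 0` and `DG(0) = I` whose image is starlike with respect to the origin
(that is, `t • w` lies in the image for all `w` in the image and `0 ≤ t ≤ 1`). -/
def IsNormalizedStarlike {X : Type*} [NormedAddCommGroup X] [NormedSpace ℂ X]
    (G : X → X) : Prop :=
  BiholomorphicOn G (Metric.ball 0 1) ∧
    G 0 = 0 ∧ fderiv ℂ G 0 = ContinuousLinearMap.id ℂ X ∧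
    StarConvex ℝ (0 : X) (G '' Metric.ball 0 1)

/-- The set `T_z` of norming functionals of `z`. -/
def normingFunctionals {X : Type*} [NormedAddCommGroup X] [NormedSpace ℂ X]
    (z : X) : Set (X →L[ℂ] ℂ) :=
  {l | l z = (‖z‖ : ℂ) ∧ ‖l‖ = 1}

/-- The `k`-th homogeneous term `D^k G(0)(z^k) / k!` of the expansion of `G` at the origin. -/
def homTerm {X : Type*} [NormedAddCommGroup X] [NormedSpace ℂ X]
    (G : X → X) (k : ℕ) (z : X) : X :=
  ((k.factorial : ℂ)⁻¹) • iteratedFDeriv ℂ k G 0 (fun _ => z)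

/-- The normalized coefficient `l (D^k G(0)(z^k)) / (k! ‖z‖^k)`. -/
def normCoeff {X : Type*} [NormedAddCommGroup X] [NormedSpace ℂ X]
    (G : X → X) (z : X) (l : X →L[ℂ] ℂ) (k : ℕ) : ℂ :=
  l (iteratedFDeriv ℂ k G 0 (fun _ => z)) / ((k.factorial : ℂ) * (‖z‖ : ℂ) ^ k)

/-- `g` is a holomorphic function on the open unit ball with `g(0) = 1` such that the map
`G(z) = z g(z)` is a normalized starlike mapping. -/
def StarlikeMultiplier {X : Type*} [NormedAddCommGroup X] [NormedSpace ℂ X]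
    (g : X → ℂ) : Prop :=
  HolomorphicOn g (Metric.ball 0 1) ∧ g 0 = 1 ∧ IsNormalizedStarlike (fun z => g z • z)

end

/-!
For a unit vector `u`, the map `G z = g z • z` sends the complex line `ℂ u` into itself, where it is
`f ζ = ζ * g (ζ • u)`, and the homogeneous terms of `G` at `c • u` are `c ^ k * a k • u` with `a k`
the Taylor coefficients of `f` (`homTerm_smul_self`, `normCoeff_smul_self`). Both upper bounds thus
follow from `‖a 2‖ ≤ 2` and `‖a 3‖ ≤ 3` and the triangle inequality.

These coefficient bounds come from the starlikeness of `G` without the differential inequality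
`Re (z f' / f) > 0`. For `0 < t < 1` the map `z ↦ G⁻¹ (t G z)` preserves the line `ℂ u`, so it gives a
self-map `ω` of the disc with `ω 0 = 0` and `f ∘ ω = t f` (`exists_shrinking_map`). By the Schwarz
lemma `φ = ω z / z` is bounded by `1`, so `P = (1 - t) / (1 - φ)` has positive real part and
`P 0 = 1`. The coefficients of `P`, computed from `f ∘ ω = t f`, are `t a 2` and
`t (1 + t) a 3 - (t a 2) ^ 2`; by Carathéodory's inequality (`caratheodory_coeff_le_two`) they are
bounded by `2`. Letting `t → 1` gives `‖a 2‖ ≤ 2` and `‖2 a 3 - a 2 ^ 2‖ ≤ 2`, hence `‖a 3‖ ≤ 3`.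

Equality needs `a 2 ^ 2 = -4` and `a 3 ^ 2 = 9`, which the rotated Koebe function `ζ / (1 - i ζ) ^ 2`
satisfies. Its extension `z ↦ (1 - i l z)⁻² z`, with `l` a norming functional of `u`, has an explicit
inverse involving a square root, and `mul_norm_one_add_sqrt_sq_le` shows that its image is starlike
(`starlikeMultiplier_koebe`).
-/

open Metric Filter Topology Asymptotics

/-! ### Coefficients of functions with positive real part -/

theorem eq_at_zero_of_mul_eq {u v : ℂ → ℂ} (hu : ContinuousAt u 0) (hv : ContinuousAt v 0)
    (h : ∀ z ∈ ball (0 : ℂ) 1, z * u z = z * v z) : u 0 = v 0 := by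
  have hev : u =ᶠ[𝓝[≠] (0 : ℂ)] v := by
    filter_upwards [self_mem_nhdsWithin, mem_nhdsWithin_of_mem_nhds (ball_mem_nhds (0 : ℂ) one_pos)]
      with z hz hb
    exact mul_left_cancel₀ hz (h z hb)
  exact tendsto_nhds_unique ((hu.tendsto.mono_left nhdsWithin_le_nhds).congr' hev)
    (hv.tendsto.mono_left nhdsWithin_le_nhds)

/-- If `F` has positive real part and `F z = 1 + K 0 * z ^ (n + 1) + ⋯`, then `‖K 0‖ ≤ 2`: the Cayley
transform `(F - 1) / (F + 1)` is bounded by `1` and vanishes to order `n + 1` at the origin, so the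
Schwarz lemma applies to it. -/
theorem norm_leading_coeff_le_two {F K : ℂ → ℂ} {n : ℕ} (hF : DifferentiableOn ℂ F (ball 0 1))
    (hre : ∀ z ∈ ball (0 : ℂ) 1, 0 < (F z).re) (hK : ContinuousAt K 0)
    (h : ∀ z ∈ ball (0 : ℂ) 1, F z = 1 + z ^ (n + 1) * K z) : ‖K 0‖ ≤ 2 := by
  have h0 : (0 : ℂ) ∈ ball (0 : ℂ) 1 := mem_ball_self one_pos
  have hne : ∀ z ∈ ball (0 : ℂ) 1, F z + 1 ≠ 0 := fun z hz he => by
    have h1 := congrArg Complex.re he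
    have h2 := hre z hz
    simp at h1
    linarith
  have hF0 : F 0 = 1 := by simpa using h 0 h0
  have hFc : ContinuousAt F 0 :=
    (hF.differentiableAt (isOpen_ball.mem_nhds h0)).continuousAt
  set W : ℂ → ℂ := fun z => (F z - 1) / (F z + 1) with hW
  have hW0 : W 0 = 0 := by simp [hW, hF0]
  have hWd : DifferentiableOn ℂ W (ball 0 1) := (hF.sub_const 1).div (hF.add_const 1) hne
  have hWle : Set.MapsTo W (ball 0 1) (closedBall (W 0) 1) := by
    intro z hz
    rw [hW0, mem_closedBall_zero_iff, hW, norm_div,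
      div_le_one (norm_pos_iff.mpr (hne z hz)), ← sq_le_sq₀ (norm_nonneg _) (norm_nonneg _),
      ← Complex.normSq_eq_norm_sq, ← Complex.normSq_eq_norm_sq]
    have := hre z hz
    simp only [Complex.normSq_apply, Complex.sub_re, Complex.sub_im, Complex.add_re,
      Complex.add_im, Complex.one_re, Complex.one_im]
    nlinarith
  have hfac : ∀ z ∈ ball (0 : ℂ) 1, W z = z ^ (n + 1) * (K z / (F z + 1)) := fun z hz => by
    rw [hW]
    simp only
    rw [h z hz]
    ring
  have hqc : ContinuousAt (fun z => K z / (F z + 1)) 0 :=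
    hK.div (hFc.add continuousAt_const) (hne 0 h0)
  have hlo : (fun z => W z - W 0) =o[𝓝 0] (fun w : ℂ => ‖w - 0‖ ^ n) := by
    have h1 : (fun z : ℂ => z ^ n * (z * (K z / (F z + 1)))) =o[𝓝 0] (fun z : ℂ => z ^ n * 1) := by
      refine (isBigO_refl _ _).mul_isLittleO ?_
      rw [isLittleO_one_iff]
      have h2 : ContinuousAt (fun z => z * (K z / (F z + 1))) 0 := continuousAt_id.mul hqc
      simpa using h2.tendsto
    refine (IsLittleO.norm_right (h1.congr' ?_ ?_)).congr_right (fun z => ?_)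
      (g₁ := fun z => ‖z ^ n‖)
    · filter_upwards [ball_mem_nhds (0 : ℂ) one_pos] with z hz
      rw [hW0, sub_zero, hfac z hz]
      ring
    · exact Eventually.of_forall fun z => mul_one _
    · simp
  have hbd : ∀ᶠ z in 𝓝[≠] (0 : ℂ), ‖K z / (F z + 1)‖ ≤ 1 := by
    filter_upwards [self_mem_nhdsWithin, mem_nhdsWithin_of_mem_nhds (ball_mem_nhds (0 : ℂ) one_pos)]
      with z hz hb
    have h1 := Complex.dist_le_mul_div_pow_of_mapsTo_ball_of_isLittleO hWd hWle hlo hb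
    rw [hW0, dist_zero_right, dist_zero_right, hfac z hb, norm_mul, norm_pow, div_one, one_mul] at h1
    have hp : 0 < ‖z‖ ^ (n + 1) := pow_pos (norm_pos_iff.mpr hz) _
    exact le_of_mul_le_mul_left (by linarith) hp
  have hlim := le_of_tendsto (hqc.norm.tendsto.mono_left nhdsWithin_le_nhds) hbd
  rw [hF0, norm_div, div_le_one (by norm_num)] at hlim
  norm_num at hlim
  exact hlim

/-- Carathéodory's inequality for the first two coefficients `p 0`, `q 0` of a function with positive
real part. For the second one the linear term is removed by passing to the even part of `P`. -/
theorem caratheodory_coeff_le_two {P p q : ℂ → ℂ} (hP : DifferentiableOn ℂ P (ball 0 1))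
    (hre : ∀ z ∈ ball (0 : ℂ) 1, 0 < (P z).re) (hp : ContinuousAt p 0) (hq : ContinuousAt q 0)
    (h₁ : ∀ z ∈ ball (0 : ℂ) 1, P z = 1 + z * p z)
    (h₂ : ∀ z ∈ ball (0 : ℂ) 1, p z = p 0 + z * q z) : ‖p 0‖ ≤ 2 ∧ ‖q 0‖ ≤ 2 := by
  refine ⟨norm_leading_coeff_le_two (n := 0) hP hre hp fun z hz => by simpa using h₁ z hz, ?_⟩
  have hneg : ∀ z ∈ ball (0 : ℂ) 1, -z ∈ ball (0 : ℂ) 1 := fun z hz => by simpa using hz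
  have hqn : ContinuousAt (fun z => q (-z)) 0 :=
    ContinuousAt.comp (f := fun z : ℂ => -z) (by simpa using hq) continuous_neg.continuousAt
  have := norm_leading_coeff_le_two (n := 1) (F := fun z => (P z + P (-z)) / 2)
    (K := fun z => (q z + q (-z)) / 2)
    ((hP.add (hP.comp (differentiable_neg.differentiableOn) hneg)).div_const 2)
    (fun z hz => by
      have h1 := hre z hz
      have h2 := hre _ (hneg z hz)
      have : ((P z + P (-z)) / 2).re = ((P z).re + (P (-z)).re) / 2 := by
        rw [← Complex.add_re]; exact Complex.div_ofNat_re _ 2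
      rw [this]; linarith)
    ((hq.add hqn).div_const 2)
    (fun z hz => by
      rw [h₁ z hz, h₁ _ (hneg z hz), h₂ z hz, h₂ _ (hneg z hz)]
      ring)
  simpa using this

/-! ### Starlike functions of one variable -/

/-- If `f z = z * g z` satisfies `f ∘ ω = t * f` for a self-map `ω` of the disc, Carathéodory's
inequality for `(1 - t) / (1 - ω z / z)` bounds these combinations of the coefficients of `f`. The
values at `0` of the iterates of `dslope · 0` are the Taylor coefficients. -/
theorem shrinking_coeff_bounds {g ω : ℂ → ℂ} {t : ℝ} (ht0 : 0 < t) (ht1 : t < 1)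
    (hg : DifferentiableOn ℂ g (ball 0 1)) (hg0 : g 0 = 1)
    (hω : DifferentiableOn ℂ ω (ball 0 1)) (hω0 : ω 0 = 0)
    (hmaps : Set.MapsTo ω (ball 0 1) (ball 0 1))
    (h : ∀ z ∈ ball (0 : ℂ) 1, ω z * g (ω z) = t * (z * g z)) :
    ‖t * dslope g 0 0‖ ≤ 2 ∧
      ‖t * (1 + t) * dslope (dslope g 0) 0 0 - (t * dslope g 0 0) ^ 2‖ ≤ 2 := by
  have hb : ball (0 : ℂ) 1 ∈ 𝓝 (0 : ℂ) := ball_mem_nhds _ one_pos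
  have h0 : (0 : ℂ) ∈ ball (0 : ℂ) 1 := mem_ball_self one_pos
  have hcont : ∀ {f : ℂ → ℂ}, DifferentiableOn ℂ f (ball 0 1) → ContinuousAt f 0 := fun hf =>
    (hf.differentiableAt hb).continuousAt
  have key : ∀ (f : ℂ → ℂ) z, f z = f 0 + z * dslope f 0 z := fun f z => by
    have := sub_smul_dslope f 0 z
    rw [sub_zero, smul_eq_mul] at this
    rw [this]; ring
  have dd : ∀ {f : ℂ → ℂ}, DifferentiableOn ℂ f (ball 0 1) →
      DifferentiableOn ℂ (dslope f 0) (ball 0 1) := fun hf =>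
    (Complex.differentiableOn_dslope hb).mpr hf
  set g1 := dslope g 0
  set g2 := dslope g1 0
  set φ := dslope ω 0
  set φ1 := dslope φ 0
  set φ2 := dslope φ1 0
  have hg1 := dd hg
  have hg2 := dd hg1
  have hφ := dd hω
  have hφ1 := dd hφ
  have hφ2 := dd hφ1
  have eω : ∀ z, ω z = z * φ z := fun z => by rw [key ω z, hω0, zero_add]
  have hωc := hcont hω
  have hφc := hcont hφ
  have hφ1c := hcont hφ1
  have hφ2c := hcont hφ2
  have hg1c : ContinuousAt (fun z => g1 (ω z)) 0 :=
    ContinuousAt.comp (by rw [hω0]; exact hcont hg1) hωc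
  have hg2c : ContinuousAt (fun z => g2 (ω z)) 0 :=
    ContinuousAt.comp (by rw [hω0]; exact hcont hg2) hωc
  have hgc : ContinuousAt (fun z => g (ω z)) 0 :=
    ContinuousAt.comp (by rw [hω0]; exact hcont hg) hωc
  -- Comparison of the coefficients of `z`, `z ^ 2`, `z ^ 3` in `f (ω z) = t * f z`.
  have b0 : φ 0 = t := by
    have := eq_at_zero_of_mul_eq (u := fun z => φ z * g (ω z)) (v := fun z => t * g z)
      (hφc.mul hgc) (continuousAt_const.mul (hcont hg)) fun z hz => by
        have := h z hz
        nth_rw 1 [eω z] at this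
        linear_combination this
    simpa [hω0, hg0] using this
  have e1 : ∀ z ∈ ball (0 : ℂ) 1, z ≠ 0 → φ1 z + φ z ^ 2 * g1 (ω z) = t * g1 z := by
    intro z hz hz0
    have h1 := h z hz
    have h2 := key g (ω z)
    have h3 := key g z
    have h4 := key φ z
    rw [h2, h3, hg0] at h1
    nth_rw 1 2 [eω z] at h1
    rw [b0] at h4
    refine mul_left_cancel₀ (pow_ne_zero 2 hz0) ?_
    linear_combination h1 - z * h4
  have b1 : φ1 0 = t * g1 0 - t ^ 2 * g1 0 := by
    have := eq_at_zero_of_mul_eq (u := fun z => φ1 z + φ z ^ 2 * g1 (ω z)) (v := fun z => t * g1 z)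
      (hφ1c.add ((hφc.pow 2).mul hg1c)) (continuousAt_const.mul (hcont hg1)) fun z hz => by
        rcases eq_or_ne z 0 with rfl | hz0
        · simp
        · rw [e1 z hz hz0]
    simp only [hω0, b0] at this
    linear_combination this
  have b2 : φ2 0 = t * g2 0 - t ^ 3 * g2 0 - 2 * t * g1 0 * φ1 0 := by
    have := eq_at_zero_of_mul_eq
      (u := fun z => φ2 z + g1 0 * φ1 z * (t + φ z) + φ z ^ 3 * g2 (ω z)) (v := fun z => t * g2 z)
      ((hφ2c.add ((continuousAt_const.mul hφ1c).mul (continuousAt_const.add hφc))).add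
        ((hφc.pow 3).mul hg2c)) (continuousAt_const.mul (hcont hg2)) fun z hz => by
        rcases eq_or_ne z 0 with rfl | hz0
        · simp
        · have h1 := e1 z hz hz0
          have h2 := key g1 (ω z)
          have h3 := key g1 z
          have h4 := key φ z
          have h5 := key φ1 z
          rw [h2, h3] at h1
          nth_rw 1 [eω z] at h1
          rw [b0] at h4
          linear_combination h1 - h5 - b1 - g1 0 * (φ z + t) * h4
    simp only [hω0, b0] at this
    linear_combination this
  have htC : (1 : ℂ) - t ≠ 0 := by
    rw [sub_ne_zero]; exact_mod_cast ht1.ne'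
  have hφle : ∀ z ∈ ball (0 : ℂ) 1, ‖φ z‖ ≤ 1 := fun z hz => by
    have := Complex.norm_dslope_le_div_of_mapsTo_ball (R₂ := 1) hω
      (by rw [hω0]; exact fun w hw => ball_subset_closedBall (hmaps hw)) hz
    simpa using this
  -- Equality would force `‖φ‖ = 1` throughout by the maximum principle, while `‖φ 0‖ = t < 1`.
  have hφlt : ∀ z ∈ ball (0 : ℂ) 1, ‖φ z‖ < 1 := fun z hz => by
    refine lt_of_le_of_ne (hφle z hz) fun he => ?_
    have hmax : IsMaxOn (norm ∘ φ) (ball 0 1) z := fun w hw => by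
      simpa [he] using hφle w hw
    have hconst : ‖φ 0‖ = ‖φ z‖ := Complex.norm_eqOn_of_isPreconnected_of_isMaxOn
      (convex_ball (0 : ℂ) 1).isPreconnected isOpen_ball hφ hz hmax h0
    rw [he, b0, Complex.norm_real, Real.norm_eq_abs, abs_of_pos ht0] at hconst
    exact ht1.ne hconst
  have hre : ∀ z ∈ ball (0 : ℂ) 1, 0 < (1 - φ z).re := fun z hz => by
    have h1 := Complex.re_le_norm (φ z)
    have h2 := hφlt z hz
    rw [Complex.sub_re, Complex.one_re]; linarith
  have hne : ∀ z ∈ ball (0 : ℂ) 1, 1 - φ z ≠ 0 := fun z hz he => by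
    have := hre z hz
    rw [he] at this; simp at this
  have hne0 : 1 - φ 0 ≠ 0 := hne 0 h0
  -- With `φ = t + z φ1` and `φ1 = φ1 0 + z φ2`, the quotient `(1 - t) / (1 - φ)` is
  -- `1 + z φ1 / (1 - φ)`; `q` is the next difference quotient.
  have hC := caratheodory_coeff_le_two (P := fun z => (1 - t) / (1 - φ z))
    (p := fun z => φ1 z / (1 - φ z))
    (q := fun z => ((1 - t) * φ2 z + φ1 0 * φ1 z) / ((1 - φ z) * (1 - t)))
    ((differentiableOn_const _).div (hφ.const_sub 1) hne)
    (fun z hz => by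
      have h1 : ((1 : ℂ) - t) / (1 - φ z) = ((1 - t : ℝ) : ℂ) * (1 - φ z)⁻¹ := by
        push_cast; rw [div_eq_mul_inv]
      rw [h1, Complex.re_ofReal_mul, Complex.inv_re]
      exact mul_pos (by linarith) (div_pos (hre z hz) (Complex.normSq_pos.mpr (hne z hz))))
    (hφ1c.div (continuousAt_const.sub hφc) hne0)
    ((by fun_prop : ContinuousAt (fun z => (1 - t) * φ2 z + φ1 0 * φ1 z) 0).div
      ((continuousAt_const.sub hφc).mul continuousAt_const) (mul_ne_zero hne0 htC))
    (fun z hz => by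
      have h1 := hne z hz
      have h2 := key φ z
      rw [b0] at h2
      field_simp
      linear_combination h2)
    (fun z hz => by
      have h1 := hne z hz
      have h2 := key φ z
      have h3 := key φ1 z
      rw [b0] at h2
      simp only [b0]
      field_simp
      linear_combination (1 - (t : ℂ)) * h3 + φ1 0 * h2)
  simp only [b0] at hC
  have e2 : φ1 0 / (1 - (t : ℂ)) = t * g1 0 := by
    rw [b1]; field_simp
  have e3 : ((1 - (t : ℂ)) * φ2 0 + φ1 0 * φ1 0) / ((1 - t) * (1 - t)) =
      t * (1 + t) * g2 0 - (t * g1 0) ^ 2 := by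
    rw [b2, b1]; field_simp; ring
  rw [e2, e3] at hC
  exact hC

/-- The bounds `‖a 2‖ ≤ 2` and `‖a 3‖ ≤ 3` for `f z = z * g z`, where starlikeness of the image of `f`
enters through the maps `ω = f⁻¹ (t f)`. -/
theorem starlike_coeff_bounds {g : ℂ → ℂ} (hg : DifferentiableOn ℂ g (ball 0 1)) (hg0 : g 0 = 1)
    (h : ∀ t : ℝ, 0 < t → t < 1 → ∃ ω : ℂ → ℂ, DifferentiableOn ℂ ω (ball 0 1) ∧ ω 0 = 0 ∧
      Set.MapsTo ω (ball 0 1) (ball 0 1) ∧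
      ∀ z ∈ ball (0 : ℂ) 1, ω z * g (ω z) = t * (z * g z)) :
    ‖dslope g 0 0‖ ≤ 2 ∧ ‖dslope (dslope g 0) 0 0‖ ≤ 3 := by
  set a := dslope g 0 0
  set b := dslope (dslope g 0) 0 0
  have hev : ∀ᶠ t : ℝ in 𝓝[<] 1, ‖(t : ℂ) * a‖ ≤ 2 ∧
      ‖(t : ℂ) * (1 + t) * b - (t * a) ^ 2‖ ≤ 2 := by
    filter_upwards [Ioo_mem_nhdsLT (zero_lt_one' ℝ)] with t ht
    obtain ⟨ω, h1, h2, h3, h4⟩ := h t ht.1 ht.2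
    exact shrinking_coeff_bounds ht.1 ht.2 hg hg0 h1 h2 h3 h4
  have c1 : Continuous fun t : ℝ => ‖(t : ℂ) * a‖ := by fun_prop
  have c2 : Continuous fun t : ℝ => ‖(t : ℂ) * (1 + t) * b - (t * a) ^ 2‖ := by fun_prop
  have l1 := le_of_tendsto ((c1.tendsto 1).mono_left nhdsWithin_le_nhds) (hev.mono fun _ h => h.1)
  have l2 := le_of_tendsto ((c2.tendsto 1).mono_left nhdsWithin_le_nhds) (hev.mono fun _ h => h.2)
  simp only [Complex.ofReal_one, one_mul] at l1 l2
  refine ⟨l1, ?_⟩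
  have h3 : ‖2 * b‖ ≤ 6 := by
    calc ‖2 * b‖ = ‖((1 + 1) * b - a ^ 2) + a ^ 2‖ := by congr 1; ring
      _ ≤ ‖(1 + 1) * b - a ^ 2‖ + ‖a‖ ^ 2 := by rw [← norm_pow]; exact norm_add_le _ _
      _ ≤ 6 := by nlinarith [norm_nonneg a]
  rw [norm_mul] at h3
  norm_num at h3
  linarith

section Slices

/-! ### Homogeneous terms along complex lines -/

variable {X : Type*} [NormedAddCommGroup X] [NormedSpace ℂ X]

/-- The `k`-th derivative on the diagonal is `k!` times the `k`-th Taylor coefficient of the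
restriction to the line through `u`. -/
theorem iteratedFDeriv_diag_eq_dslope [CompleteSpace X] {F : X → X} (hF : AnalyticAt ℂ F 0)
    (k : ℕ) (u : X) :
    iteratedFDeriv ℂ k F 0 (fun _ => u) =
      (k.factorial : ℂ) • (Function.swap dslope 0)^[k] (fun ζ : ℂ => F (ζ • u)) 0 := by
  obtain ⟨p, r, hp⟩ := hF
  have hL : HasFPowerSeriesAt F p ((ContinuousLinearMap.toSpanSingleton ℂ u) 0) := by
    rw [map_zero]; exact hp.hasFPowerSeriesAt
  have hs : HasFPowerSeriesAt (fun ζ : ℂ => F (ζ • u))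
      (p.compContinuousLinearMap (ContinuousLinearMap.toSpanSingleton ℂ u)) 0 :=
    hL.compContinuousLinearMap
  have h1 := (hs.has_fpower_series_iterate_dslope_fslope k).coeff_zero 1
  have h2 := FormalMultilinearSeries.coeff_iterate_fslope (p := p.compContinuousLinearMap
    (ContinuousLinearMap.toSpanSingleton ℂ u)) k 0
  rw [← hp.factorial_smul u k, ← h1, ← FormalMultilinearSeries.coeff, h2, zero_add,
    FormalMultilinearSeries.coeff, FormalMultilinearSeries.compContinuousLinearMap_apply,
    Nat.cast_smul_eq_nsmul]
  congr 2
  ext i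
  simp

theorem iteratedFDeriv_smul_self_diag [CompleteSpace X] {g : X → ℂ} (hg : AnalyticAt ℂ g 0)
    (k : ℕ) (c : ℂ) (u : X) :
    iteratedFDeriv ℂ (k + 1) (fun w => g w • w) 0 (fun _ => c • u) =
      (c ^ (k + 1) * ((k + 1).factorial : ℂ) *
        (Function.swap dslope 0)^[k] (fun ζ : ℂ => g (ζ • u)) 0) • u := by
  have hu : (fun _ : Fin (k + 1) => c • u) = fun i => (fun _ => c) i • (fun _ => u) i := rfl
  have hG : AnalyticAt ℂ (fun w => g w • w) 0 := hg.smul analyticAt_id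
  rw [hu, ContinuousMultilinearMap.map_smul_univ, iteratedFDeriv_diag_eq_dslope hG (k + 1) u,
    Finset.prod_const, Finset.card_univ, Fintype.card_fin,
    mul_smul, mul_smul]
  congr 2
  have hslice : ContinuousAt (fun ζ : ℂ => g (ζ • u)) 0 := by
    have : ContinuousAt g ((0 : ℂ) • u) := by rw [zero_smul]; exact hg.continuousAt
    exact ContinuousAt.comp (f := fun ζ : ℂ => ζ • u) this (by fun_prop)
  -- The first difference quotient divides out the factor `ζ`.
  have hd : dslope (fun ζ : ℂ => g (ζ • u) • ζ • u) 0 = fun ζ => g (ζ • u) • u := by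
    funext ζ
    rcases eq_or_ne ζ 0 with rfl | hζ
    · rw [dslope_same]
      have h1 : HasDerivAt (fun ζ : ℂ => g (ζ • u) • ζ • u) (g ((0 : ℂ) • u) • u) 0 := by
        rw [hasDerivAt_iff_tendsto_slope]
        have h2 : ContinuousAt (fun ζ : ℂ => g (ζ • u) • u) 0 := hslice.smul continuousAt_const
        refine (h2.tendsto.mono_left nhdsWithin_le_nhds).congr' ?_
        filter_upwards [self_mem_nhdsWithin] with z hz
        have hz' : z ≠ 0 := hz
        rw [slope_def_module, sub_zero, zero_smul, smul_zero, sub_zero,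
          smul_comm (g (z • u)), inv_smul_smul₀ hz']
      exact h1.deriv
    · rw [dslope_of_ne _ hζ, slope_def_module, sub_zero, zero_smul, smul_zero, sub_zero,
        smul_comm (g (ζ • u)), inv_smul_smul₀ hζ]
  have hcomm : ∀ (m : ℕ) (f : ℂ → ℂ), AnalyticAt ℂ f 0 →
      (Function.swap dslope 0)^[m] (fun ζ => f ζ • u) 0 =
        (Function.swap dslope 0)^[m] f 0 • u := by
    intro m
    induction m with
    | zero => intro f _; rfl
    | succ m ih =>
      intro f hf
      obtain ⟨p, hp⟩ := hf
      rw [Function.iterate_succ_apply, Function.iterate_succ_apply,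
        ← ih _ ⟨_, hp.has_fpower_series_dslope_fslope⟩]
      exact congrArg (fun F => (Function.swap dslope 0)^[m] F 0) (funext fun ζ =>
        (ContinuousLinearMap.toSpanSingleton ℂ u).dslope_comp f 0 ζ fun _ => hp.differentiableAt)
  have han : AnalyticAt ℂ (fun ζ : ℂ => g (ζ • u)) 0 := by
    have h1 : AnalyticAt ℂ g ((ContinuousLinearMap.toSpanSingleton ℂ u) 0) := by simpa using hg
    exact h1.comp (ContinuousLinearMap.analyticAt _ _)
  rw [Function.iterate_succ_apply, ← hcomm k _ han]
  exact congrArg (fun f => (Function.swap dslope 0)^[k] f 0) hd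

/-- The `k`-th Taylor coefficient at `0` of `ζ ↦ g (ζ • u)`, written as an iterated difference
quotient. It is the coefficient of `ζ ^ (k + 1)` in `ζ * g (ζ • u)`. -/
noncomputable def sliceCoeff (g : X → ℂ) (u : X) (k : ℕ) : ℂ :=
  (Function.swap dslope 0)^[k] (fun ζ : ℂ => g (ζ • u)) 0

theorem homTerm_smul_self [CompleteSpace X] {g : X → ℂ} (hg : AnalyticAt ℂ g 0)
    (k : ℕ) (c : ℂ) (u : X) :
    homTerm (fun w => g w • w) (k + 1) (c • u) = (c ^ (k + 1) * sliceCoeff g u k) • u := by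
  have hk : ((k + 1).factorial : ℂ) ≠ 0 := by exact_mod_cast (k + 1).factorial_ne_zero
  rw [homTerm, iteratedFDeriv_smul_self_diag hg, smul_smul, sliceCoeff]
  congr 1
  field_simp

theorem normCoeff_smul_self [CompleteSpace X] {g : X → ℂ} (hg : AnalyticAt ℂ g 0) (k : ℕ)
    {r : ℝ} (hr : 0 < r) {u : X} (hu : ‖u‖ = 1) {l : X →L[ℂ] ℂ}
    (hl : l ∈ normingFunctionals ((r : ℂ) • u)) :
    normCoeff (fun w => g w • w) ((r : ℂ) • u) l (k + 1) = sliceCoeff g u k := by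
  have hk : ((k + 1).factorial : ℂ) ≠ 0 := by exact_mod_cast (k + 1).factorial_ne_zero
  have hrC : (r : ℂ) ≠ 0 := by exact_mod_cast hr.ne'
  have hn : ‖(r : ℂ) • u‖ = r := by simp [norm_smul, hu, abs_of_pos hr]
  have hlu : l u = 1 := by
    have h1 := hl.1
    rw [hn, map_smul, smul_eq_mul] at h1
    exact mul_left_cancel₀ hrC (by rw [h1, mul_one])
  rw [normCoeff, iteratedFDeriv_smul_self_diag hg, map_smul, hlu, hn, sliceCoeff, smul_eq_mul]
  field_simp

/-! ### Coefficient bounds along complex lines -/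

/-- The map `z ↦ G⁻¹ (t G z)` in the coordinate of the line `ℂ u`, where `G z = g z • z`. -/
theorem exists_shrinking_map {g : X → ℂ} (hg : StarlikeMultiplier g) {u : X} (hu : ‖u‖ = 1)
    {t : ℝ} (ht0 : 0 < t) (ht1 : t < 1) :
    ∃ ω : ℂ → ℂ, DifferentiableOn ℂ ω (ball 0 1) ∧ ω 0 = 0 ∧
      Set.MapsTo ω (ball 0 1) (ball 0 1) ∧
      ∀ z ∈ ball (0 : ℂ) 1, ω z * g (ω z • u) = t * (z * g (z • u)) := by
  obtain ⟨hgh, -, ⟨-, -, -, k, hk, hkl⟩, -, -, hstar⟩ := hg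
  obtain ⟨l, -, hlu⟩ := exists_dual_vector ℂ u (by simp [hu])
  replace hlu : l u = 1 := by simpa [hu] using hlu
  have hB : ∀ z ∈ ball (0 : ℂ) 1, z • u ∈ ball (0 : X) 1 := fun z hz => by
    simpa [norm_smul, hu] using hz
  have h0 : (0 : X) ∈ ball (0 : X) 1 := mem_ball_self one_pos
  have hk0 : k 0 = 0 := by simpa using hkl 0 h0
  have hmem : ∀ z ∈ ball (0 : ℂ) 1,
      (t : ℂ) • g (z • u) • z • u ∈ (fun w => g w • w) '' ball (0 : X) 1 := fun z hz => by
    rw [Complex.coe_smul]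
    exact hstar.smul_mem (Set.mem_image_of_mem _ (hB z hz)) ht0.le ht1.le
  -- `g w • w` lies on the line `ℂ u`; then so does `w`, even if `g w = 0`, since injectivity of `G`
  -- gives `w = 0` in that case.
  have hline : ∀ z ∈ ball (0 : ℂ) 1, ∃ c : ℂ, ‖c‖ < 1 ∧
      k ((t : ℂ) • g (z • u) • z • u) = c • u ∧ c * g (c • u) = t * (z * g (z • u)) := by
    intro z hz
    obtain ⟨w, hw, hwe⟩ := hmem z hz
    have hwe' : g w • w = (t : ℂ) • g (z • u) • z • u := hwe
    have hkw : k ((t : ℂ) • g (z • u) • z • u) = w := by rw [← hwe']; exact hkl w hw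
    have hc : ∃ c : ℂ, w = c • u := by
      by_cases hgw : g w = 0
      · refine ⟨0, ?_⟩
        rw [zero_smul, ← hkl w hw]
        simp [hgw, hk0]
      · refine ⟨(g w)⁻¹ * (t * (g (z • u) * z)), ?_⟩
        rw [mul_smul, mul_smul, mul_smul, ← hwe', smul_smul, inv_mul_cancel₀ hgw, one_smul]
    obtain ⟨c, rfl⟩ := hc
    refine ⟨c, by simpa [norm_smul, hu] using hw, hkw, ?_⟩
    have h1 := congrArg l hwe'
    simp only [map_smul, hlu, smul_eq_mul, mul_one] at h1
    linear_combination h1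
  refine ⟨fun z => l (k ((t : ℂ) • g (z • u) • z • u)), fun z hz => ?_, by simp [hk0],
    fun z hz => ?_, fun z hz => ?_⟩
  · have h1 : DifferentiableAt ℂ k ((t : ℂ) • g (z • u) • z • u) :=
      (hk _ (hmem z hz)).differentiableAt
    have h2 : DifferentiableAt ℂ g (z • u) := (hgh _ (hB z hz)).differentiableAt
    have h3 : DifferentiableAt ℂ (fun z : ℂ => z • u) z := by fun_prop
    have h4 : DifferentiableAt ℂ (fun z : ℂ => (t : ℂ) • g (z • u) • z • u) z :=
      ((DifferentiableAt.comp (g := g) z h2 h3).smul h3).const_smul _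
    exact (l.differentiableAt.comp z
      (DifferentiableAt.comp (g := k) z h1 h4)).differentiableWithinAt
  · obtain ⟨c, hc, hkc, -⟩ := hline z hz
    rw [mem_ball_zero_iff]
    beta_reduce
    rw [hkc, map_smul, hlu, smul_eq_mul, mul_one]
    exact hc
  · obtain ⟨c, -, hkc, h1⟩ := hline z hz
    beta_reduce
    rw [hkc, map_smul, hlu, smul_eq_mul, mul_one]
    exact h1

theorem sliceCoeff_bounds {g : X → ℂ} (hg : StarlikeMultiplier g) {u : X} (hu : ‖u‖ = 1) :
    ‖sliceCoeff g u 1‖ ≤ 2 ∧ ‖sliceCoeff g u 2‖ ≤ 3 := by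
  refine starlike_coeff_bounds (g := fun ζ : ℂ => g (ζ • u)) (fun z hz => ?_)
    (by simp [hg.2.1]) fun t ht0 ht1 => exists_shrinking_map hg hu ht0 ht1
  have h2 : DifferentiableAt ℂ g (z • u) :=
    (hg.1 _ (by simpa [norm_smul, hu] using hz)).differentiableAt
  exact (DifferentiableAt.comp (g := g) z h2
    (by fun_prop : DifferentiableAt ℂ (fun z : ℂ => z • u) z)).differentiableWithinAt

/-! ### The square root and the slit plane -/

/-- The inequality behind starlikeness of the Koebe image: `t |1 + √A|²` does not exceed the value of
`|1 + √·|²` at the point `1 - t + t A` of the segment from `1` to `A`. It follows from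
`|1 + √A|² = 1 + 2 Re √A + |A|` and the half-angle formula for `Re √A`. -/
theorem mul_norm_one_add_sqrt_sq_le (A : ℂ) {t : ℝ} (ht0 : 0 ≤ t) (ht1 : t ≤ 1) :
    t * ‖1 + A ^ (2⁻¹ : ℂ)‖ ^ 2 ≤ ‖1 + (1 - t + t * A) ^ (2⁻¹ : ℂ)‖ ^ 2 := by
  have expand : ∀ B : ℂ, ‖1 + B ^ (2⁻¹ : ℂ)‖ ^ 2 = 1 + 2 * √((‖B‖ + B.re) / 2) + ‖B‖ := by
    intro B
    have h1 : ‖B ^ (2⁻¹ : ℂ)‖ ^ 2 = ‖B‖ := by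
      rw [← norm_pow, Complex.cpow_ofNat_inv_pow]
    rw [← Complex.cpow_inv_two_re, ← h1, ← Complex.normSq_eq_norm_sq, ← Complex.normSq_eq_norm_sq]
    simp only [Complex.normSq_apply, Complex.add_re, Complex.add_im, Complex.one_re,
      Complex.one_im]
    ring
  have hnorm : t * ‖A‖ ≤ ‖1 - t + t * A‖ + (1 - t) := by
    calc t * ‖A‖ = ‖(1 - t + t * A) - ((1 - t : ℝ) : ℂ)‖ := by
          push_cast
          rw [add_sub_cancel_left, norm_mul, Complex.norm_real, Real.norm_eq_abs, abs_of_nonneg ht0]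
      _ ≤ ‖1 - t + t * A‖ + ‖((1 - t : ℝ) : ℂ)‖ := norm_sub_le _ _
      _ = _ := by rw [Complex.norm_real, Real.norm_eq_abs, abs_of_nonneg (by linarith)]
  have hre : (1 - (t : ℂ) + t * A).re = 1 - t + t * A.re := by simp
  have hA : 0 ≤ ‖A‖ + A.re := by linarith [neg_le_of_abs_le (Complex.abs_re_le_norm A)]
  have hsqrt : t * √((‖A‖ + A.re) / 2) ≤
      √((‖1 - (t : ℂ) + t * A‖ + (1 - (t : ℂ) + t * A).re) / 2) := by
    apply Real.le_sqrt_of_sq_le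
    rw [mul_pow, Real.sq_sqrt (by linarith), hre]
    nlinarith [mul_nonneg (mul_nonneg ht0 (sub_nonneg.mpr ht1)) hA]
  rw [expand, expand]
  nlinarith

theorem sqrt_re_pos {A : ℂ} (hA : A ∈ Complex.slitPlane) : 0 < (A ^ (2⁻¹ : ℂ)).re := by
  rw [Complex.cpow_inv_two_re]
  apply Real.sqrt_pos.mpr
  rcases Complex.mem_slitPlane_iff.mp hA with h | h
  · positivity
  · have h2 : |A.re| < ‖A‖ := Complex.abs_re_lt_norm.mpr h
    linarith [neg_lt_of_abs_lt h2]

theorem sq_mem_slitPlane {q : ℂ} (hq : 0 < q.re) : q ^ 2 ∈ Complex.slitPlane := by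
  rw [Complex.mem_slitPlane_iff, pow_two, Complex.mul_re, Complex.mul_im]
  by_cases h : q.im = 0
  · left; rw [h]; nlinarith
  · right
    intro h'
    have : q.re * q.im = 0 := by linarith
    exact (mul_ne_zero hq.ne' h) this

/-! ### The Koebe extremal map -/

/-- The factor `(1 - i l z)⁻²`, for which `koebeMultiplier l z • z` restricts to the rotated Koebe
function `ζ / (1 - i ζ) ^ 2` on a line `ℂ u` with `l u = 1`. -/
noncomputable def koebeMultiplier (l : X →L[ℂ] ℂ) (z : X) : ℂ :=
  ((1 - Complex.I * l z) ^ 2)⁻¹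

/-- The inverse of `z ↦ koebeMultiplier l z • z`, with the principal square root. It is holomorphic
where `1 + 4 i l w` avoids the nonpositive real axis. -/
noncomputable def koebeInverse (l : X →L[ℂ] ℂ) (w : X) : X :=
  (4 / (1 + (1 + 4 * Complex.I * l w) ^ (2⁻¹ : ℂ)) ^ 2) • w

variable {l : X →L[ℂ] ℂ}

theorem norm_I_mul_lt_one (hl : ‖l‖ = 1) {z : X} (hz : z ∈ ball (0 : X) 1) :
    ‖Complex.I * l z‖ < 1 := by
  have h1 := l.le_opNorm z
  rw [hl, one_mul] at h1
  rw [norm_mul, Complex.norm_I, one_mul]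
  exact h1.trans_lt (by simpa using hz)

theorem one_sub_ne_zero_of_norm_lt_one {s : ℂ} (hs : ‖s‖ < 1) : 1 - s ≠ 0 := fun h => by
  rw [← sub_eq_zero.mp h] at hs; simp at hs

/-- The Koebe function as the square of a Cayley transform. -/
theorem one_add_koebe (l : X →L[ℂ] ℂ) {z : X} (hz : 1 - Complex.I * l z ≠ 0) :
    1 + 4 * Complex.I * l (koebeMultiplier l z • z) =
      ((1 + Complex.I * l z) / (1 - Complex.I * l z)) ^ 2 := by
  rw [map_smul, smul_eq_mul, koebeMultiplier]
  field_simp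
  ring

theorem cayley_re_pos {s : ℂ} (hs : ‖s‖ < 1) : 0 < ((1 + s) / (1 - s)).re := by
  have h0 := one_sub_ne_zero_of_norm_lt_one hs
  have h1 : s.re * s.re + s.im * s.im < 1 := by
    rw [← Complex.normSq_apply, Complex.normSq_eq_norm_sq]
    nlinarith [norm_nonneg s]
  rw [Complex.div_re, ← add_div]
  apply div_pos _ (Complex.normSq_pos.mpr h0)
  simp only [Complex.add_re, Complex.sub_re, Complex.add_im, Complex.sub_im, Complex.one_re,
    Complex.one_im]
  nlinarith

theorem koebe_mem_slitPlane (hl : ‖l‖ = 1) {z : X} (hz : z ∈ ball (0 : X) 1) :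
    1 + 4 * Complex.I * l (koebeMultiplier l z • z) ∈ Complex.slitPlane := by
  have hs := norm_I_mul_lt_one hl hz
  rw [one_add_koebe l (one_sub_ne_zero_of_norm_lt_one hs)]
  exact sq_mem_slitPlane (cayley_re_pos hs)

theorem koebeInverse_koebe (hl : ‖l‖ = 1) {z : X} (hz : z ∈ ball (0 : X) 1) :
    koebeInverse l (koebeMultiplier l z • z) = z := by
  have hs := norm_I_mul_lt_one hl hz
  have hne := one_sub_ne_zero_of_norm_lt_one hs
  rw [koebeInverse, one_add_koebe l hne, Complex.sq_cpow_two_inv (cayley_re_pos hs),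
    koebeMultiplier, smul_smul]
  have h1 : 1 + (1 + Complex.I * l z) / (1 - Complex.I * l z) = 2 / (1 - Complex.I * l z) := by
    field_simp; ring
  rw [h1]
  convert one_smul ℂ z using 2
  field_simp
  norm_num

theorem koebe_koebeInverse (l : X →L[ℂ] ℂ) {w : X}
    (hw : 1 + 4 * Complex.I * l w ∈ Complex.slitPlane) :
    koebeMultiplier l (koebeInverse l w) • koebeInverse l w = w := by
  have hq := sqrt_re_pos hw
  have hq2 : ((1 + 4 * Complex.I * l w) ^ (2⁻¹ : ℂ)) ^ 2 = 1 + 4 * Complex.I * l w :=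
    Complex.cpow_ofNat_inv_pow _ _
  rw [koebeMultiplier, koebeInverse]
  set q := (1 + 4 * Complex.I * l w) ^ (2⁻¹ : ℂ)
  have hne : 1 + q ≠ 0 := fun h => by
    have := congrArg Complex.re h
    simp at this
    linarith
  have h1 : 1 - Complex.I * l ((4 / (1 + q) ^ 2) • w) = 2 / (1 + q) := by
    rw [map_smul, smul_eq_mul]
    field_simp
    linear_combination hq2
  rw [h1, smul_smul]
  convert one_smul ℂ w using 2
  field_simp
  norm_num

theorem image_koebe (hl : ‖l‖ = 1) :
    (fun z => koebeMultiplier l z • z) '' ball (0 : X) 1 =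
      {w | 1 + 4 * Complex.I * l w ∈ Complex.slitPlane} ∩ koebeInverse l ⁻¹' ball 0 1 := by
  ext w
  constructor
  · rintro ⟨z, hz, rfl⟩
    refine ⟨koebe_mem_slitPlane hl hz, ?_⟩
    rw [Set.mem_preimage, koebeInverse_koebe hl hz]
    exact hz
  · rintro ⟨hw, hb⟩
    exact ⟨_, hb, koebe_koebeInverse l hw⟩

theorem analyticOnNhd_koebeInverse (l : X →L[ℂ] ℂ) :
    AnalyticOnNhd ℂ (koebeInverse l) {w | 1 + 4 * Complex.I * l w ∈ Complex.slitPlane} := by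
  intro w hw
  have hlin : AnalyticAt ℂ (fun w => 1 + 4 * Complex.I * l w) w :=
    analyticAt_const.add (analyticAt_const.mul (l.analyticAt w))
  have hsq : AnalyticAt ℂ (fun w => 1 + (1 + 4 * Complex.I * l w) ^ (2⁻¹ : ℂ)) w :=
    analyticAt_const.add (hlin.cpow analyticAt_const hw)
  refine (analyticAt_const.div (hsq.pow 2) ?_).smul analyticAt_id
  refine pow_ne_zero 2 fun h => ?_
  have h1 := congrArg Complex.re h
  have h2 := sqrt_re_pos hw
  simp at h1
  linarith

/-- The image of the ball is the open set where `1 + 4 i l w` lies in the slit plane and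
`koebeInverse l w` in the ball (`image_koebe`). The slit plane is star-shaped about `1`, and
`mul_norm_one_add_sqrt_sq_le` gives `‖koebeInverse l (t • w)‖ ≤ ‖koebeInverse l w‖`. -/
theorem starlikeMultiplier_koebe (hl : ‖l‖ = 1) : StarlikeMultiplier (koebeMultiplier l) := by
  have hga : HolomorphicOn (koebeMultiplier l) (ball 0 1) := fun z hz =>
    ((analyticAt_const.sub (analyticAt_const.mul (l.analyticAt z))).pow 2).inv
      (pow_ne_zero 2 (one_sub_ne_zero_of_norm_lt_one (norm_I_mul_lt_one hl hz)))
  have hg0 : koebeMultiplier l 0 = 1 := by simp [koebeMultiplier]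
  have hG : HolomorphicOn (fun z => koebeMultiplier l z • z) (ball 0 1) := fun z hz =>
    (hga z hz).smul analyticAt_id
  have hopen : IsOpen {w | 1 + 4 * Complex.I * l w ∈ Complex.slitPlane} :=
    Complex.isOpen_slitPlane.preimage (by fun_prop)
  have h0 : (0 : X) ∈ ball (0 : X) 1 := mem_ball_self one_pos
  refine ⟨hga, hg0, ⟨hG, ?_, ?_, koebeInverse l, ?_, fun z hz => koebeInverse_koebe hl hz⟩,
    by simp, ?_, ?_⟩
  · rw [image_koebe hl]
    exact (analyticOnNhd_koebeInverse l).continuousOn.isOpen_inter_preimage hopen isOpen_ball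
  · exact ((isConnected_ball one_pos).image _ hG.continuousOn : _)
  · rw [image_koebe hl]
    exact (analyticOnNhd_koebeInverse l).mono Set.inter_subset_left
  · have h1 := (hga 0 h0).differentiableAt.hasFDerivAt.smul (hasFDerivAt_id (𝕜 := ℂ) (0 : X))
    refine HasFDerivAt.fderiv (h1.congr_fderiv ?_)
    ext v
    simp [hg0]
  · rw [image_koebe hl, starConvex_zero_iff]
    rintro w ⟨hw, hb⟩ t ht0 ht1
    have hA : 1 + 4 * Complex.I * l (t • w) = 1 - t + t * (1 + 4 * Complex.I * l w) := by
      rw [← Complex.coe_smul, map_smul, smul_eq_mul]; ring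
    have hq := sqrt_re_pos hw
    have hmem : 1 + 4 * Complex.I * l (t • w) ∈ Complex.slitPlane := by
      rw [hA]
      rcases Complex.mem_slitPlane_iff.mp hw with h | h
      · refine Complex.mem_slitPlane_iff.mpr (Or.inl ?_)
        have : (1 - (t : ℂ) + t * (1 + 4 * Complex.I * l w)).re =
          1 - t + t * (1 + 4 * Complex.I * l w).re := by
            rw [Complex.add_re, Complex.re_ofReal_mul]; simp
        rw [this]
        rcases ht0.eq_or_lt with rfl | h0
        · simp
        · have := mul_pos h0 h
          linarith
      · rcases ht0.eq_or_lt with rfl | h0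
        · simp
        · refine Complex.mem_slitPlane_iff.mpr (Or.inr ?_)
          rw [Complex.add_im, Complex.im_ofReal_mul]
          simpa using ⟨h0.ne', by simpa using h⟩
    refine ⟨hmem, ?_⟩
    have hq' := sqrt_re_pos hmem
    have hle := mul_norm_one_add_sqrt_sq_le (1 + 4 * Complex.I * l w) ht0 ht1
    rw [← hA] at hle
    rw [Set.mem_preimage, mem_ball_zero_iff, koebeInverse, norm_smul, norm_div, norm_pow] at hb ⊢
    have pos : ∀ q : ℂ, 0 < q.re → 0 < ‖1 + q‖ ^ 2 := fun q hq => by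
      refine pow_pos (norm_pos_iff.mpr fun h => ?_) 2
      have := congrArg Complex.re h
      simp at this
      linarith
    have p1 := pos _ hq
    have p2 := pos _ hq'
    rw [div_mul_eq_mul_div, div_lt_one p1] at hb
    rw [div_mul_eq_mul_div, div_lt_one p2, norm_smul, Real.norm_eq_abs, abs_of_nonneg ht0]
    rcases ht0.eq_or_lt with rfl | h0
    · simp
    · nlinarith [mul_lt_mul_of_pos_left hb h0]

/-- The rotated Koebe function `ζ / (1 - i ζ) ^ 2` is `ζ + 2 i ζ ^ 2 - 3 ζ ^ 3 + ⋯`. -/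
theorem sliceCoeff_koebe {u : X} (hlu : l u = 1) :
    sliceCoeff (koebeMultiplier l) u 1 = 2 * Complex.I ∧
      sliceCoeff (koebeMultiplier l) u 2 = -3 := by
  have hne : ∀ z ∈ ball (0 : ℂ) 1, 1 - Complex.I * z ≠ 0 := fun z hz =>
    one_sub_ne_zero_of_norm_lt_one (by simpa using hz)
  have h0 : (0 : ℂ) ∈ ball (0 : ℂ) 1 := mem_ball_self one_pos
  have hslice : (fun ζ : ℂ => koebeMultiplier l (ζ • u)) = fun ζ => ((1 - Complex.I * ζ) ^ 2)⁻¹ := by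
    funext ζ
    simp [koebeMultiplier, hlu]
  have hmul : ∀ (f : ℂ → ℂ) z, z * dslope f 0 z = f z - f 0 := fun f z => by
    simpa using sub_smul_dslope f 0 z
  set f : ℂ → ℂ := fun ζ => ((1 - Complex.I * ζ) ^ 2)⁻¹ with hf
  have hb : ball (0 : ℂ) 1 ∈ 𝓝 (0 : ℂ) := ball_mem_nhds _ one_pos
  have hfd : DifferentiableOn ℂ f (ball 0 1) :=
    DifferentiableOn.inv (by fun_prop) fun z hz => pow_ne_zero 2 (hne z hz)
  have hd1 := (Complex.differentiableOn_dslope hb).mpr hfd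
  have hd2 := (Complex.differentiableOn_dslope hb).mpr hd1
  have e1 : ∀ z ∈ ball (0 : ℂ) 1, z * dslope f 0 z =
      z * (Complex.I * (2 - Complex.I * z) / (1 - Complex.I * z) ^ 2) := fun z hz => by
    have := hne z hz
    rw [hmul]
    simp only [hf]
    field_simp
    ring
  have c1 : dslope f 0 0 = 2 * Complex.I := by
    have := eq_at_zero_of_mul_eq (u := dslope f 0)
      (v := fun z => Complex.I * (2 - Complex.I * z) / (1 - Complex.I * z) ^ 2)
      (hd1.differentiableAt hb).continuousAt
      (ContinuousAt.div (by fun_prop) (by fun_prop) (pow_ne_zero 2 (hne 0 h0))) e1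
    rw [this]; simp [mul_comm]
  have c2 : dslope (dslope f 0) 0 0 = -3 := by
    have := eq_at_zero_of_mul_eq (u := dslope (dslope f 0) 0)
      (v := fun z => -(3 - 2 * (Complex.I * z)) / (1 - Complex.I * z) ^ 2)
      (hd2.differentiableAt hb).continuousAt
      (ContinuousAt.div (by fun_prop) (by fun_prop) (pow_ne_zero 2 (hne 0 h0)))
      fun z hz => by
        rcases eq_or_ne z 0 with rfl | hz0
        · simp
        · have h1 := hne z hz
          rw [hmul, c1, mul_left_cancel₀ hz0 (e1 z hz)]
          field_simp
          ring_nf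
          simp only [Complex.I_sq, Complex.I_pow_three]
          ring
    rw [this]; simp
  rw [sliceCoeff, sliceCoeff, hslice]
  exact ⟨c1, c2⟩

end Slices

/-! ### Sharp estimates on the unit ball and on the polydisc -/

theorem Pi.norm_sq_eq {ι : Type*} [Fintype ι] (u : ι → ℂ) : ‖u ^ 2‖ = ‖u‖ ^ 2 := by
  refine le_antisymm (norm_pow_le' _ two_pos) ?_
  have h : ‖u‖ ≤ √‖u ^ 2‖ := (pi_norm_le_iff_of_nonneg (Real.sqrt_nonneg _)).mpr fun i => by
    apply Real.le_sqrt_of_sq_le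
    rw [← norm_pow]
    exact norm_le_pi_norm (u ^ 2) i
  calc ‖u‖ ^ 2 ≤ √‖u ^ 2‖ ^ 2 := by gcongr
    _ = ‖u ^ 2‖ := Real.sq_sqrt (norm_nonneg _)

theorem StarlikeMultiplier.analyticAt_zero {X : Type*} [NormedAddCommGroup X] [NormedSpace ℂ X]
    {g : X → ℂ} (hg : StarlikeMultiplier g) : AnalyticAt ℂ g 0 :=
  hg.1 0 (mem_ball_self one_pos)

/-- Both squares are multiples of the componentwise square `u ^ 2`, whose maximum norm is `1`. -/
theorem norm_homTerm_sq_sub {n : ℕ} {g : (Fin n → ℂ) → ℂ} (hg : AnalyticAt ℂ g 0) (r : ℝ)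
    {u : Fin n → ℂ} (hu : ‖u‖ = 1) :
    ‖homTerm (fun w => g w • w) 3 ((r : ℂ) • u) ^ 2
        - homTerm (fun w => g w • w) 2 ((r : ℂ) • u) ^ 2‖ =
      ‖(r : ℂ) ^ 6 * sliceCoeff g u 2 ^ 2 - (r : ℂ) ^ 4 * sliceCoeff g u 1 ^ 2‖ := by
  rw [homTerm_smul_self hg 2, homTerm_smul_self hg 1, smul_pow, smul_pow, ← sub_smul, norm_smul,
    Pi.norm_sq_eq, hu, one_pow, mul_one]
  congr 1
  ring

theorem exists_eq_norm_smul {X : Type*} [NormedAddCommGroup X] [NormedSpace ℂ X] {z : X}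
    (hz : z ≠ 0) : ∃ u : X, ‖u‖ = 1 ∧ z = (‖z‖ : ℂ) • u := by
  have h : (‖z‖ : ℂ) ≠ 0 := by exact_mod_cast norm_ne_zero_iff.mpr hz
  exact ⟨(‖z‖ : ℂ)⁻¹ • z, by simp [norm_smul, hz], (smul_inv_smul₀ h z).symm⟩

theorem mainTheorem8 {X : Type*} [NormedAddCommGroup X] [NormedSpace ℂ X] [CompleteSpace X]
    (n : ℕ) :
    -- the bound on the unit ball of `X`
    (∀ g : X → ℂ, StarlikeMultiplier g →
      ∀ z ∈ Metric.ball (0 : X) 1, z ≠ 0 → ∀ l ∈ normingFunctionals z,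
        ‖normCoeff (fun w => g w • w) z l 2 ^ 2 - normCoeff (fun w => g w • w) z l 3 ^ 2‖ ≤ 13) ∧
    -- its sharpness
    (∀ u : X, ‖u‖ = 1 → ∃ g : X → ℂ, StarlikeMultiplier g ∧
      ∀ r : ℝ, 0 < r → r < 1 → ∀ l ∈ normingFunctionals ((r : ℂ) • u),
        ‖normCoeff (fun w => g w • w) ((r : ℂ) • u) l 2 ^ 2
          - normCoeff (fun w => g w • w) ((r : ℂ) • u) l 3 ^ 2‖ = 13) ∧
    -- the bound on the polydisc (maximum norm, squares taken componentwise)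
    (∀ g : (Fin n → ℂ) → ℂ, StarlikeMultiplier g →
      ∀ z ∈ Metric.ball (0 : Fin n → ℂ) 1,
        ‖homTerm (fun w => g w • w) 3 z ^ 2 - homTerm (fun w => g w • w) 2 z ^ 2‖
          ≤ 9 * ‖z‖ ^ 6 + 4 * ‖z‖ ^ 4) ∧
    -- its sharpness
    (∀ u : Fin n → ℂ, ‖u‖ = 1 → ∃ g : (Fin n → ℂ) → ℂ, StarlikeMultiplier g ∧
      ∀ r : ℝ, 0 ≤ r → r < 1 →
        ‖homTerm (fun w => g w • w) 3 ((r : ℂ) • u) ^ 2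
            - homTerm (fun w => g w • w) 2 ((r : ℂ) • u) ^ 2‖
          = 9 * ‖(r : ℂ) • u‖ ^ 6 + 4 * ‖(r : ℂ) • u‖ ^ 4) := by
  refine ⟨fun g hg z _ hz0 l hl => ?_, fun u hu => ?_, fun g hg z _ => ?_, fun u hu => ?_⟩
  · obtain ⟨u, hu, hzu⟩ := exists_eq_norm_smul hz0
    have hr := norm_pos_iff.mpr hz0
    obtain ⟨h1, h2⟩ := sliceCoeff_bounds hg hu
    generalize ‖z‖ = r at hzu hr
    subst hzu
    rw [normCoeff_smul_self hg.analyticAt_zero 1 hr hu hl,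
      normCoeff_smul_self hg.analyticAt_zero 2 hr hu hl]
    refine (norm_sub_le _ _).trans ?_
    rw [norm_pow, norm_pow]
    nlinarith [norm_nonneg (sliceCoeff g u 1), norm_nonneg (sliceCoeff g u 2)]
  · obtain ⟨l₀, hl₀, hlu⟩ := exists_dual_vector ℂ u (by simp [hu])
    obtain ⟨h1, h2⟩ := sliceCoeff_koebe (l := l₀) (u := u) (by simpa [hu] using hlu)
    have hg := starlikeMultiplier_koebe hl₀
    refine ⟨koebeMultiplier l₀, hg, fun r hr _ l hl => ?_⟩
    rw [normCoeff_smul_self hg.analyticAt_zero 1 hr hu hl,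
      normCoeff_smul_self hg.analyticAt_zero 2 hr hu hl, h1, h2, mul_pow, Complex.I_sq]
    norm_num
  · rcases eq_or_ne z 0 with rfl | hz0
    · have h := homTerm_smul_self hg.analyticAt_zero
      have h3 := h 2 0 0
      have h2 := h 1 0 0
      norm_num at h2 h3
      simp [h2, h3]
    obtain ⟨u, hu, hzu⟩ := exists_eq_norm_smul hz0
    obtain ⟨h1, h2⟩ := sliceCoeff_bounds hg hu
    have hr := norm_nonneg z
    rw [show homTerm (fun w => g w • w) 3 z = homTerm (fun w => g w • w) 3 ((‖z‖ : ℂ) • u) by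
      rw [← hzu], show homTerm (fun w => g w • w) 2 z =
        homTerm (fun w => g w • w) 2 ((‖z‖ : ℂ) • u) by rw [← hzu],
      norm_homTerm_sq_sub hg.analyticAt_zero _ hu]
    refine (norm_sub_le _ _).trans ?_
    simp only [norm_mul, norm_pow, Complex.norm_real, norm_norm]
    have h3 : ‖sliceCoeff g u 2‖ ^ 2 ≤ 9 := by nlinarith [norm_nonneg (sliceCoeff g u 2)]
    have h4 : ‖sliceCoeff g u 1‖ ^ 2 ≤ 4 := by nlinarith [norm_nonneg (sliceCoeff g u 1)]
    nlinarith [mul_le_mul_of_nonneg_left h3 (pow_nonneg hr 6),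
      mul_le_mul_of_nonneg_left h4 (pow_nonneg hr 4)]
  · obtain ⟨l₀, hl₀, hlu⟩ := exists_dual_vector ℂ u (by simp [hu])
    obtain ⟨h1, h2⟩ := sliceCoeff_koebe (l := l₀) (u := u) (by simpa [hu] using hlu)
    have hg := starlikeMultiplier_koebe hl₀
    refine ⟨koebeMultiplier l₀, hg, fun r hr _ => ?_⟩
    rw [norm_homTerm_sq_sub hg.analyticAt_zero _ hu, h1, h2, norm_smul, hu, mul_one,
      Complex.norm_real, Real.norm_eq_abs, abs_of_nonneg hr, mul_pow, Complex.I_sq]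
    have : (r : ℂ) ^ 6 * (-3) ^ 2 - (r : ℂ) ^ 4 * (2 ^ 2 * -1) =
        ((9 * r ^ 6 + 4 * r ^ 4 : ℝ) : ℂ) := by
      push_cast; ring
    rw [this, Complex.norm_real, Real.norm_eq_abs, abs_of_nonneg (by positivity)]
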